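/- Recall that a subgroup $H$ of a group $K$ is a \emph{retract} of $K$ if there is a homomorphism $\rho : K \to H$ which restricts to the identity map on $H$; a subgroup $H$ of a group $G$ is a \emph{virtual retract} of $G$ if there is a subgroup $K \leqslant G$ of finite index such that $H \subseteq K$ and $H$ is a retract of $K$; and $G$ has \emph{property (VRC)} if every cyclic subgroup of $G$ is a virtual retract of $G$. \textbf{Theorem.} Let $P$ and $Q$ be groups, let $R \leqslant P$ be a retract of $P$, let $S \leqslant Q$ be a retract of $Q$, let $\varphi : R \to S$ be an isomorphism, and let $$G = P *_{R=S} Q = \langle P, Q \,\|\, r = \varphi(r) \ \ \forall\, r \in R \rangle$$ be the corresponding amalgamated free product, that is, the quotient of the free product $P * Q$ by the normal closure of the set $\{ r\,\varphi(r)^{-1} \mid r \in R \}$. If $P$ and $Q$ both have (VRC), then $G$ has (VRC). -/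

import Mathlib

universe u v

/-- A subgroup `H` of a group `K` is a retract if there is a homomorphism `K → H` which restricts
to the identity map on `H`. -/
def Subgroup.IsRetract {K : Type u} [Group K] (H : Subgroup K) : Prop :=
  ∃ ρ : K →* H, ∀ h : H, ρ (h : K) = h

/-- A subgroup `H` of a group `G` is a virtual retract of `G` if it is a retract of some
finite index subgroup `K ≤ G` which contains `H`. -/
def Subgroup.IsVirtualRetract {G : Type u} [Group G] (H : Subgroup G) : Prop :=
  ∃ K : Subgroup G, K.FiniteIndex ∧ H ≤ K ∧ (H.subgroupOf K).IsRetract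

/-- Property (VRC): every cyclic subgroup is a virtual retract. -/
def PropertyVRC (G : Type u) [Group G] : Prop :=
  ∀ A : Subgroup G, IsCyclic A → A.IsVirtualRetract

/-- The amalgamated free product `P *_{R=S} Q = ⟨P, Q ‖ r = φ(r) for all r ∈ R⟩` of groups `P`
and `Q` along an isomorphism `φ` between subgroups `R ≤ P` and `S ≤ Q`: the quotient of the free
product of `P` and `Q` by the normal closure of all the elements `r φ(r)⁻¹`, `r ∈ R`. -/
abbrev AmalgamatedProduct {P : Type u} {Q : Type v} [Group P] [Group Q]
    {R : Subgroup P} {S : Subgroup Q} (φ : R ≃* S) : Type (max u v) :=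
  Monoid.Coprod P Q ⧸ Subgroup.normalClosure
    (Set.range fun r : R =>
      (Monoid.Coprod.inl (r : P) : Monoid.Coprod P Q) * (Monoid.Coprod.inr (φ r : Q))⁻¹)

/-! Each element of `G` is conjugate into `P` or `Q`, or to a product `p₁q₁⋯pₙqₙ` with all letters
outside `R` and `S`. In the first case `G` retracts onto the factor, and virtual retractions pull
back along this retraction (`isVirtualRetract_zpowers_of_section`).

In the second case, (VRC) makes `P` and `Q` residually finite, so they map to finite groups `A`, `B`
with a common retract `C`, the letters staying outside `C`. An `A`-set and a `B`-set are glued along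
a `ℤ × C`-equivariant bijection, chosen so that the word moves some point to its translate by `1`
(`exists_translation_action`). The stabiliser of the `ℤ`-line through that point has finite index,
and displacement along the line is a homomorphism to `ℤ` sending the word to `1`
(`isVirtualRetract_zpowers_of_translation`). -/

open Equiv

/-! ### Virtual retracts generated by one element. -/

/-- A cyclic subgroup `⟨g⟩` is a virtual retract as soon as some finite index subgroup containing
`g` maps to `⟨g⟩` by a homomorphism fixing `g`. -/
theorem isVirtualRetract_zpowers_iff {G : Type*} [Group G] {g : G} :
    (Subgroup.zpowers g).IsVirtualRetract ↔
      ∃ (K : Subgroup G) (hg : g ∈ K) (f : K →* G), K.FiniteIndex ∧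
        (∀ k, f k ∈ Subgroup.zpowers g) ∧ f ⟨g, hg⟩ = g := by
  constructor
  · rintro ⟨K, hK, hle, ρ, hρ⟩
    have hg : g ∈ K := hle (Subgroup.mem_zpowers g)
    refine ⟨K, hg, K.subtype.comp ((Subgroup.subtype _).comp ρ),
      hK, fun k => (ρ k).2, ?_⟩
    have := hρ ⟨⟨g, hg⟩, Subgroup.mem_subgroupOf.2 (Subgroup.mem_zpowers g)⟩
    simp [this]
  · rintro ⟨K, hg, f, hK, hf, hfg⟩
    have hle : Subgroup.zpowers g ≤ K := by simpa using hg
    refine ⟨K, hK, hle, ((f.codRestrict K fun k => hle (hf k)).codRestrict _ fun k =>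
      Subgroup.mem_subgroupOf.2 (hf k)), ?_⟩
    rintro ⟨⟨h, hh⟩, hh'⟩
    obtain ⟨k, rfl⟩ := Subgroup.mem_zpowers_iff.1 (Subgroup.mem_subgroupOf.1 hh')
    have : (⟨g ^ k, hh⟩ : K) = ⟨g, hg⟩ ^ k := rfl
    ext
    simp [this, hfg]

theorem propertyVRC_iff {G : Type*} [Group G] :
    PropertyVRC G ↔ ∀ g : G, (Subgroup.zpowers g).IsVirtualRetract := by
  refine ⟨fun h g => h _ inferInstance, fun h A hA => ?_⟩
  obtain ⟨g, rfl⟩ := A.isCyclic_iff_exists_zpowers_eq_top.1 hA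
  exact h g

theorem finiteIndex_comap {G H : Type*} [Group G] [Group H] (f : G →* H) (K : Subgroup H)
    [K.FiniteIndex] : (K.comap f).FiniteIndex :=
  ⟨by rw [Subgroup.index_comap]; exact (K.subgroupOf f.range).index_ne_zero_of_finite⟩

/-- Being a virtual retract passes from `⟨h⟩` to its image under a section. -/
theorem isVirtualRetract_zpowers_of_section {G H : Type*} [Group G] [Group H] (σ : H →* G)
    (π : G →* H) (hσ : ∀ h, π (σ h) = h) {h : H}
    (hh : (Subgroup.zpowers h).IsVirtualRetract) : (Subgroup.zpowers (σ h)).IsVirtualRetract := by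
  obtain ⟨K, hK, f, hfin, hf, hfh⟩ := isVirtualRetract_zpowers_iff.1 hh
  refine isVirtualRetract_zpowers_iff.2 ⟨K.comap π, by simpa [hσ] using hK,
    σ.comp (f.comp (π.subgroupComap K)), finiteIndex_comap π K, fun k => ?_, ?_⟩
  · rw [← MonoidHom.map_zpowers]
    exact Subgroup.mem_map_of_mem _ (hf _)
  · have : π.subgroupComap K ⟨σ h, by simpa [hσ] using hK⟩ = ⟨h, hK⟩ := Subtype.ext (hσ h)
    simp [this, hfh]

theorem isVirtualRetract_zpowers_conj {G : Type*} [Group G] {g : G}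
    (hg : (Subgroup.zpowers g).IsVirtualRetract) (x : G) :
    (Subgroup.zpowers (x * g * x⁻¹)).IsVirtualRetract :=
  isVirtualRetract_zpowers_of_section (MulAut.conj x).toMonoidHom (MulAut.conj x)⁻¹.toMonoidHom
    (fun h => by simp [mul_assoc]) hg

theorem isVirtualRetract_zpowers_mul_comm {G : Type*} [Group G] {x y : G}
    (h : (Subgroup.zpowers (y * x)).IsVirtualRetract) :
    (Subgroup.zpowers (x * y)).IsVirtualRetract := by
  simpa [mul_assoc] using isVirtualRetract_zpowers_conj h x

/-! ### Actions commuting with translations of `ℤ`. -/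

/-- Left translation of the first coordinate. -/
def translation {Z : Type*} [Group Z] (C E : Type*) (z : Z) : Perm ((Z × C) × E) :=
  ((Equiv.mulLeft z).prodCongr (Equiv.refl C)).prodCongr (Equiv.refl E)

theorem translation_apply {Z C E : Type*} [Group Z] (z : Z) (y : (Z × C) × E) :
    translation C E z y = ((z * y.1.1, y.1.2), y.2) := rfl

/-- If `G` acts on `(ℤ × C) × E`, with `C` and `E` finite, by permutations commuting with the
translations of `ℤ`, then an element translating some point by `1` generates a virtual retract. -/
theorem isVirtualRetract_zpowers_of_translation {G C E : Type*} [Group G] [Finite C] [Finite E]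
    (Φ : G →* Perm ((Multiplicative ℤ × C) × E))
    (hΦ : ∀ g z, Commute (Φ g) (translation C E z))
    {g : G} {y : (Multiplicative ℤ × C) × E}
    (hg : Φ g y = translation C E (.ofAdd 1) y) :
    (Subgroup.zpowers g).IsVirtualRetract := by
  obtain ⟨⟨z, c⟩, e⟩ := y
  -- Commuting with translations, `Φ k` is determined on the line through `((z, c), e)` by its value
  -- at that point.
  have hfiber : ∀ k w, (Φ k ((w, c), e)) = ((w * z⁻¹ * (Φ k ((z, c), e)).1.1,
      (Φ k ((z, c), e)).1.2), (Φ k ((z, c), e)).2) := fun k w => by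
    simpa [translation_apply] using Perm.congr_fun (hΦ k (w * z⁻¹)).eq ((z, c), e)
  let K : Subgroup G :=
    { carrier := {k | ∃ w, Φ k ((z, c), e) = ((w, c), e)}
      one_mem' := ⟨z, by simp⟩
      mul_mem' := by
        rintro a b ⟨w, hw⟩ ⟨v, hv⟩
        exact ⟨_, by rw [map_mul, Perm.mul_apply, hv, hfiber, hw]⟩
      inv_mem' := by
        rintro a ⟨w, hw⟩
        refine ⟨z * w⁻¹ * z, ?_⟩
        rw [map_inv, Perm.inv_eq_iff_eq, hfiber, hw]
        simp }
  have hK : ∀ k : K, Φ k ((z, c), e) = (((Φ k ((z, c), e)).1.1, c), e) := by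
    rintro ⟨k, w, hw⟩
    simp [hw]
  have hgK : g ∈ K := ⟨_, hg⟩
  let f : K →* Multiplicative ℤ := MonoidHom.mk' (fun k => (Φ k ((z, c), e)).1.1 * z⁻¹) <| by
    intro a b
    have : (Φ ↑(a * b) ((z, c), e)) = Φ a (Φ b ((z, c), e)) := by simp
    rw [this, hK b, hfiber]
    simp only
    rw [mul_comm, ← mul_assoc, mul_comm, mul_comm z⁻¹]
    simp only [mul_comm, mul_left_comm]
  refine isVirtualRetract_zpowers_iff.2 ⟨K, hgK, (zpowersHom G g).comp f, ?_, fun k => ?_, ?_⟩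
  -- Cosets of `K` correspond to the lines in the orbit, and `C × E` indexes all lines.
  · let q : G ⧸ K → C × E := Quotient.lift (fun k : G =>
      ((Φ k ((z, c), e)).1.2, (Φ k ((z, c), e)).2)) <| by
        intro a b hab
        obtain ⟨w, hw⟩ := QuotientGroup.leftRel_apply.1 hab
        have : Φ b ((z, c), e) = Φ a ((w, c), e) := by rw [← hw]; simp
        rw [this, hfiber a w]
    have hq : Function.Injective q := by
      rintro ⟨a⟩ ⟨b⟩ hab
      change ((Φ a ((z, c), e)).1.2, (Φ a ((z, c), e)).2) =
        ((Φ b ((z, c), e)).1.2, (Φ b ((z, c), e)).2) at hab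
      refine QuotientGroup.eq.2 ?_
      have h1 : (Φ a ((z, c), e)).1.2 = (Φ b ((z, c), e)).1.2 := (Prod.ext_iff.1 hab).1
      have h2 : (Φ a ((z, c), e)).2 = (Φ b ((z, c), e)).2 := (Prod.ext_iff.1 hab).2
      refine ⟨z * (Φ a ((z, c), e)).1.1⁻¹ * (Φ b ((z, c), e)).1.1, ?_⟩
      rw [map_mul, Perm.mul_apply, map_inv, Perm.inv_eq_iff_eq, hfiber a, h1, h2]
      refine Prod.ext (Prod.ext (Multiplicative.toAdd.injective ?_) rfl) rfl
      simp only [toAdd_mul, toAdd_inv]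
      ring
    have := Finite.of_injective q hq
    exact Subgroup.finiteIndex_of_finite_quotient
  · exact ⟨Multiplicative.toAdd (f k), by simp⟩
  · have : f ⟨g, hgK⟩ = .ofAdd 1 := by simp [f, hg, translation_apply]
    simp [this]

/-! ### Gluing actions of two finite groups with a common retract. -/

/-- A matching between orbits of two free actions of `D` with finitely many orbits extends to an
equivariant bijection. -/
theorem exists_equivariant_equiv {D E E' J : Type*} [Group D] [Finite E] (ε : E ≃ E')
    {e : J → E} {e' : J → E'} (he : e.Injective) (he' : e'.Injective) (d d' : J → D) :
    ∃ β : D × E ≃ D × E', (∀ x y u, β (x * y, u) = (x * (β (y, u)).1, (β (y, u)).2)) ∧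
      ∀ j, β (d j, e j) = (d' j, e' j) := by
  classical
  have := Fintype.ofFinite E
  have hε : Function.Injective (ε.symm ∘ e') := ε.symm.injective.comp he'
  -- Finiteness of `E` lets the partial matching of orbits extend to a bijection. Then `t` adjusts
  -- positions inside orbits by right multiplication, which commutes with the left action.
  let θ : Perm E := ((ofInjective e he).symm.trans (ofInjective _ hε)).extendSubtype
  have hθ : ∀ j, ε (θ (e j)) = e' j := fun j => by
    have := extendSubtype_apply_of_mem ((ofInjective e he).symm.trans (ofInjective _ hε)) (e j)
      ⟨j, rfl⟩
    have h2 : (⟨e j, ⟨j, rfl⟩⟩ : Set.range e) = ofInjective e he j := rfl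
    rw [show θ (e j) = _ from this, h2]
    simp
  let t : E → D := Function.extend e (fun j => (d j)⁻¹ * d' j) 1
  refine ⟨{ toFun := fun y => (y.1 * t y.2, ε (θ y.2))
            invFun := fun y => (y.1 * (t (θ.symm (ε.symm y.2)))⁻¹, θ.symm (ε.symm y.2))
            left_inv := fun y => by simp
            right_inv := fun y => by simp }, fun x y u => by simp [mul_assoc], fun j => ?_⟩
  simp [hθ, t, he.extend_apply]

/-- Left multiplication of a group `A` with a retract `C`, in the coordinates `A ≃ C × ker π`,
with extra inert factors `Z` and `F`. -/
def retractAction {A C : Type*} [Group A] [Group C] (ι : C →* A) (π : A →* C)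
    (h : ∀ c, π (ι c) = c) (Z F : Type*) : A →* Perm ((Z × C) × (π.ker × F)) :=
  MonoidHom.toHomPerm
    { toFun := fun a y => ((y.1.1, π (a * ι y.1.2 * y.2.1)),
        (⟨(ι (π (a * ι y.1.2 * y.2.1)))⁻¹ * (a * ι y.1.2 * y.2.1), by
          rw [MonoidHom.mem_ker, map_mul, map_inv, h, inv_mul_cancel]⟩, y.2.2))
      map_one' := by
        funext ⟨⟨z, c⟩, ⟨⟨n, hn⟩, f⟩⟩
        simp [Function.End.one_def, MonoidHom.mem_ker.1 hn, h]
      map_mul' := fun a b => by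
        funext y
        change _ = (_, _)
        simp [h, mul_assoc] }

section retractAction

variable {A C Z F : Type*} [Group A] [Group C] (ι : C →* A) (π : A →* C) (h : ∀ c, π (ι c) = c)

theorem retractAction_apply (a : A) (z : Z) (c : C) (n : π.ker) (f : F) :
    retractAction ι π h Z F a ((z, c), (n, f)) = ((z, π (a * ι c * n)),
      (⟨(ι (π (a * ι c * n)))⁻¹ * (a * ι c * n), by
        rw [MonoidHom.mem_ker, map_mul, map_inv, h, inv_mul_cancel]⟩, f)) := rfl

theorem commute_retractAction_translation [Group Z] (a : A) (z : Z) :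
    Commute (retractAction ι π h Z F a) (translation C _ z) :=
  Equiv.ext fun _ => rfl

/-- Since `C` acts by left multiplication on its own coordinate only, conjugating by a `Z ×
C`-equivariant bijection preserves its action; this is what allows gluing. -/
theorem retractAction_section [Group Z] (c : C) (x : Z × C) (e : π.ker × F) :
    retractAction ι π h Z F (ι c) (x, e) = ((1, c) * x, e) := by
  obtain ⟨z, b⟩ := x
  obtain ⟨⟨n, hn⟩, f⟩ := e
  rw [retractAction_apply]
  simp [h, MonoidHom.mem_ker.1 hn, mul_assoc]

end retractAction

theorem list_prod_apply_of_chain {Y : Type*} (L : List (Perm Y)) (y : ℕ → Y)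
    (h : ∀ (i : ℕ) (hi : i < L.length), L[i] (y (i + 1)) = y i) : L.prod (y L.length) = y 0 := by
  induction L generalizing y with
  | nil => rfl
  | cons σ L ih =>
    have := ih (fun i => y (i + 1)) fun i hi => h (i + 1) (by simpa using hi)
    rw [List.prod_cons, List.length_cons, Perm.mul_apply, this]
    exact h 0 (by simp)

/-- Given finite groups `A` and `B` with a common retract `C` and a nonempty alternating product
of elements of `A` and `B` outside `C`, there are compatible actions of `A` and `B` on
`(ℤ × C) × E`, with `E` finite, for which this product translates some point by `1`. -/
theorem exists_translation_action {A B C : Type*} [Group A] [Group B] [Group C]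
    [Finite A] [Finite B] (ι : C →* A) (π : A →* C) (h : ∀ c, π (ι c) = c)
    (ι' : C →* B) (π' : B →* C) (h' : ∀ c, π' (ι' c) = c)
    (L : List (A × B)) (hL : L ≠ []) (hA : ∀ x ∈ L, x.1 ∉ ι.range) (hB : ∀ x ∈ L, x.2 ∉ ι'.range) :
    ∃ (Φ : A →* Perm ((Multiplicative ℤ × C) × (π.ker × (π'.ker × Fin L.length))))
      (Φ' : B →* Perm ((Multiplicative ℤ × C) × (π.ker × (π'.ker × Fin L.length)))),
      (∀ c, Φ (ι c) = Φ' (ι' c)) ∧ (∀ a z, Commute (Φ a) (translation _ _ z)) ∧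
      (∀ b z, Commute (Φ' b) (translation _ _ z)) ∧
      ∃ y, (L.map fun x => Φ x.1 * Φ' x.2).prod y = translation _ _ (.ofAdd 1) y := by
  let n := L.length
  have : NeZero n := ⟨by simpa [n] using hL⟩
  let ε : π.ker × (π'.ker × Fin n) ≃ π'.ker × (π.ker × Fin n) :=
    { toFun := fun x => (x.2.1, (x.1, x.2.2))
      invFun := fun x => (x.2.1, (x.1, x.2.2))
      left_inv := fun _ => rfl
      right_inv := fun _ => rfl }
  let N : A → π.ker := fun a => ⟨(ι (π a))⁻¹ * a, by
    rw [MonoidHom.mem_ker, map_mul, map_inv, h, inv_mul_cancel]⟩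
  let N' : B → π'.ker := fun b => ⟨(ι' (π' b))⁻¹ * b, by
    rw [MonoidHom.mem_ker, map_mul, map_inv, h', inv_mul_cancel]⟩
  have hN : ∀ i : Fin n, N L[i].1 ≠ 1 := fun i hi => hA L[i] (List.getElem_mem _)
    ⟨π L[i].1, by simpa [N, Subtype.ext_iff, inv_mul_eq_one] using hi⟩
  have hN' : ∀ i : Fin n, N' L[i].2 ≠ 1 := fun i hi => hB L[i] (List.getElem_mem _)
    ⟨π' L[i].2, by simpa [N', Subtype.ext_iff, inv_mul_eq_one] using hi⟩
  -- The jump closing up the word: `y n` is `y 0` translated by `-1`.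
  let w : ℕ → Multiplicative ℤ := fun i => if i < n then 1 else .ofAdd (-1)
  -- Under `β`, `.inl i` identifies the `i`-th `B`-base point with `L[i].1` times the `i`-th
  -- `A`-base point; `.inr i` identifies the latter with `L[i].2` times the cyclically next `B`-base
  -- point, translated by `w (i + 1)`. The orbits are distinct because the letters lie outside `C`.
  let e : Fin n ⊕ Fin n → π.ker × (π'.ker × Fin n) :=
    Sum.elim (fun i => (N L[i].1, (1, i))) fun i => (1, (1, i))
  let e' : Fin n ⊕ Fin n → π'.ker × (π.ker × Fin n) :=
    Sum.elim (fun i => (1, (1, i))) fun i => (N' L[i].2, (1, i + 1))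
  have he : e.Injective := by
    refine Function.Injective.sumElim (fun i j hij => ?_) (fun i j hij => ?_) fun i j hij => ?_
    · exact (Prod.ext_iff.1 (Prod.ext_iff.1 hij).2).2
    · exact (Prod.ext_iff.1 (Prod.ext_iff.1 hij).2).2
    · exact hN i (Prod.ext_iff.1 hij).1
  have he' : e'.Injective := by
    refine Function.Injective.sumElim (fun i j hij => ?_) (fun i j hij => ?_) fun i j hij => ?_
    · exact (Prod.ext_iff.1 (Prod.ext_iff.1 hij).2).2
    · exact add_left_injective 1 (Prod.ext_iff.1 (Prod.ext_iff.1 hij).2).2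
    · exact hN' j (Prod.ext_iff.1 hij).1.symm
  obtain ⟨β, hβ, hβe⟩ := exists_equivariant_equiv ε he he'
    (Sum.elim (fun i => ((1 : Multiplicative ℤ), π L[i].1)) fun _ => 1)
    (Sum.elim (fun _ => 1) fun i => (w (i + 1), π' L[i].2))
  have hβt : ∀ z y, β (translation _ _ z y) = translation _ _ z (β y) := fun z y => by
    obtain ⟨⟨v, c⟩, u⟩ := y
    have := hβ (z, 1) (v, c) u
    simpa [translation_apply, Prod.mul_def] using this
  have hβt' : ∀ z y, β.symm (translation _ _ z y) = translation _ _ z (β.symm y) := fun z y => by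
    rw [Equiv.symm_apply_eq, hβt, Equiv.apply_symm_apply]
  let Φ := retractAction ι π h (Multiplicative ℤ) (π'.ker × Fin n)
  let Ψ := retractAction ι' π' h' (Multiplicative ℤ) (π.ker × Fin n)
  let Φ' := β.symm.permCongrHom.toMonoidHom.comp Ψ
  have hΦ' : ∀ b y, Φ' b y = β.symm (Ψ b (β y)) := fun b y => rfl
  let y₀ : Fin n → (Multiplicative ℤ × C) × (π.ker × (π'.ker × Fin n)) :=
    fun i => β.symm (1, (1, (1, i)))
  let y : ℕ → (Multiplicative ℤ × C) × (π.ker × (π'.ker × Fin n)) :=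
    fun i => translation _ _ (w i) (y₀ (Fin.ofNat n i))
  refine ⟨Φ, Φ', fun c => ?_, commute_retractAction_translation ι π h, fun b z => ?_, y n, ?_⟩
  · refine Equiv.ext fun x => ?_
    rw [hΦ', Equiv.eq_symm_apply]
    obtain ⟨x, u⟩ := x
    rw [retractAction_section, retractAction_section, hβ]
  · refine Equiv.ext fun x => ?_
    have := Perm.congr_fun (commute_retractAction_translation ι' π' h'
      (F := π.ker × Fin n) b z).eq (β x)
    simp only [Perm.mul_apply] at this ⊢
    rw [hΦ', hΦ', hβt, this, hβt']
  · have hchain := list_prod_apply_of_chain (L.map fun x => Φ x.1 * Φ' x.2) y fun i hi => ?_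
    · rw [List.length_map] at hchain
      rw [hchain]
      have h0 : w 0 = 1 := if_pos (NeZero.pos n)
      have hn : w n = .ofAdd (-1) := if_neg (lt_irrefl n)
      simp [y, h0, hn, translation_apply]
    · have hi' : i < n := by simpa using hi
      have h1 : β.symm (1, (1, (1, ⟨i, hi'⟩))) = ((1, π L[i].1), (N L[i].1, (1, ⟨i, hi'⟩))) := by
        rw [Equiv.symm_apply_eq]
        exact (hβe (.inl ⟨i, hi'⟩)).symm
      have h2 : β.symm ((w (i + 1), π' L[i].2), (N' L[i].2, (1, ⟨i, hi'⟩ + 1))) =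
          (1, (1, (1, ⟨i, hi'⟩))) := by
        rw [Equiv.symm_apply_eq]
        exact (hβe (.inr ⟨i, hi'⟩)).symm
      have h3 : Fin.ofNat n i = ⟨i, hi'⟩ := Fin.ext (Nat.mod_eq_of_lt hi')
      have h4 : Fin.ofNat n (i + 1) = ⟨i, hi'⟩ + 1 := by
        rw [← h3]
        exact Fin.ext (by simp [Fin.val_add])
      have h5 : w i = 1 := if_pos hi'
      have h6 : Φ' L[i].2 (y (i + 1)) = (1, (1, (1, ⟨i, hi'⟩))) := by
        rw [hΦ', ← h2]
        simp only [y, y₀]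
        rw [hβt, Equiv.apply_symm_apply, h4]
        congr 1
        simp [Ψ, translation_apply, retractAction_apply, N', ← Prod.mk_one_one]
      rw [List.getElem_map, Perm.mul_apply, h6]
      simp only [y, y₀]
      rw [h3, h1, h5]
      simp [Φ, translation_apply, retractAction_apply, N, ← Prod.mk_one_one]

/-! ### Residual finiteness from (VRC), and reduction to finite groups. -/

theorem PropertyVRC.exists_finiteIndex_notMem {P : Type*} [Group P] (hP : PropertyVRC P) {p : P}
    (hp : p ≠ 1) : ∃ M : Subgroup P, M.FiniteIndex ∧ p ∉ M := by
  obtain ⟨K, hpK, f, hK, hf, hfp⟩ :=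
    isVirtualRetract_zpowers_iff.1 (propertyVRC_iff.1 hP p)
  let F : K →* Subgroup.zpowers p := f.codRestrict _ hf
  -- Chosen so that `p` is not an `m`-th power in `⟨p⟩`: in finite order all `m`-th powers are
  -- trivial.
  let m : ℕ := if orderOf p = 0 then 2 else orderOf p
  have hm : m ≠ 0 := by
    by_cases h : orderOf p = 0 <;> simp [m, h]
  let _ : CommGroup (Subgroup.zpowers p) := IsCyclic.commGroup
  have : Group.FG (Subgroup.zpowers p) := (Group.fg_iff_subgroup_fg _).2
    ⟨{p}, by rw [Finset.coe_singleton, Subgroup.zpowers_eq_closure]⟩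
  let U : Subgroup (Subgroup.zpowers p) :=
    (powMonoidHom (α := Subgroup.zpowers p) m).range
  have hU : U.FiniteIndex :=
    Subgroup.finiteIndex_range_powMonoidHom_of_fg _ hm
  have hFU : (U.comap F).FiniteIndex := finiteIndex_comap F U
  refine ⟨(U.comap F).map K.subtype, ⟨?_⟩, ?_⟩
  · rw [Subgroup.index_map_subtype]
    exact mul_ne_zero hFU.index_ne_zero hK.index_ne_zero
  · rintro ⟨x, ⟨⟨_, k, rfl⟩, hy⟩, hxp⟩
    obtain rfl : x = ⟨p, hpK⟩ := Subtype.ext hxp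
    have h1 : (p ^ k) ^ m = p := by
      have := congrArg Subtype.val hy
      simpa [F, hfp] using this
    have h2 : p ^ (k * m - 1 : ℤ) = 1 := by
      rw [zpow_sub_one, zpow_mul, zpow_natCast, h1, mul_inv_cancel]
    have h3 := orderOf_dvd_iff_zpow_eq_one.2 h2
    by_cases h : orderOf p = 0
    · simp only [h, m, if_true, Nat.cast_zero, zero_dvd_iff] at h3
      push_cast at h3
      omega
    · simp only [h, m, if_false] at h3
      have h4 : (orderOf p : ℤ) ∣ 1 := by
        have := dvd_sub (dvd_mul_left (orderOf p : ℤ) k) h3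
        simpa using this
      exact hp (orderOf_eq_one_iff.1 (by exact_mod_cast Int.eq_one_of_dvd_one (by positivity) h4))

theorem PropertyVRC.exists_normal_finiteIndex_notMem {P : Type*} [Group P] (hP : PropertyVRC P)
    (l : List P) (hl : ∀ x ∈ l, x ≠ 1) :
    ∃ M : Subgroup P, M.Normal ∧ M.FiniteIndex ∧ ∀ x ∈ l, x ∉ M := by
  induction l with
  | nil => exact ⟨⊤, inferInstance, inferInstance, by simp⟩
  | cons p l ih =>
    obtain ⟨M, hM, hM', hMl⟩ := ih fun x hx => hl x (List.mem_cons_of_mem _ hx)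
    obtain ⟨M₁, hM₁, hp⟩ := hP.exists_finiteIndex_notMem (hl p List.mem_cons_self)
    refine ⟨M₁.normalCore ⊓ M, inferInstance, inferInstance, ?_⟩
    rintro x (_ | ⟨_, hx⟩) h
    · exact hp (M₁.normalCore_le h.1)
    · exact hMl x hx h.2

/-- A group `P` with a retraction `ρ` onto `R`, reduced modulo `M ⊴ P` and `T ⊴ R`. -/
def reduction {P : Type*} [Group P] {R : Subgroup P} (ρ : P →* R) (M : Subgroup P) [M.Normal]
    (T : Subgroup R) [T.Normal] : P →* (P ⧸ M) × (R ⧸ T) :=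
  (QuotientGroup.mk' M).prod ((QuotientGroup.mk' T).comp ρ)

/-- The copy of `R ⧸ T` in the reduction of `P`. -/
def reductionSection {P : Type*} [Group P] {R : Subgroup P} (M : Subgroup P) [M.Normal]
    (T : Subgroup R) [T.Normal] (hT : T ≤ M.subgroupOf R) : R ⧸ T →* (P ⧸ M) × (R ⧸ T) :=
  (QuotientGroup.map T M R.subtype hT).prod (MonoidHom.id _)

theorem reduction_coe {P : Type*} [Group P] {R : Subgroup P} {ρ : P →* R}
    (hρ : ∀ r : R, ρ r = r) (M : Subgroup P) [M.Normal]
    (T : Subgroup R) [T.Normal] (hT : T ≤ M.subgroupOf R) (r : R) :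
    reduction ρ M T r = reductionSection M T hT r := by
  simp only [reduction, reductionSection, MonoidHom.prod_apply, MonoidHom.comp_apply, hρ]
  rfl

/-- The second coordinate forces a preimage to be the class of `ρ p`; the first then says that `ρ p`
and `p` agree modulo `M`. -/
theorem reduction_notMem {P : Type*} [Group P] {R : Subgroup P} {ρ : P →* R}
    (M : Subgroup P) [M.Normal] (T : Subgroup R) [T.Normal] (hT : T ≤ M.subgroupOf R) {p : P}
    (hp : (ρ p : P)⁻¹ * p ∉ M) : reduction ρ M T p ∉ (reductionSection M T hT).range := by
  rintro ⟨c, hc⟩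
  obtain rfl : c = (ρ p : R ⧸ T) := congrArg Prod.snd hc
  exact hp (QuotientGroup.eq.1 (congrArg Prod.fst hc))

/-! ### The amalgamated product and its universal property. -/

section Amalgam

variable {P Q : Type*} [Group P] [Group Q] {R : Subgroup P} {S : Subgroup Q} (φ : R ≃* S)

namespace AmalgamatedProduct

/-- The canonical homomorphism from `P`. -/
def inl : P →* AmalgamatedProduct φ := (QuotientGroup.mk' _).comp Monoid.Coprod.inl

/-- The canonical homomorphism from `Q`. -/
def inr : Q →* AmalgamatedProduct φ := (QuotientGroup.mk' _).comp Monoid.Coprod.inr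

theorem inl_eq_inr (r : R) : inl φ (r : P) = inr φ (φ r : Q) := by
  rw [← mul_inv_eq_one]
  exact (QuotientGroup.eq_one_iff _).2 (Subgroup.subset_normalClosure ⟨r, rfl⟩)

variable {φ} in
/-- The universal property of the amalgamated product. -/
def lift {G : Type*} [Group G] (f : P →* G) (g : Q →* G) (h : ∀ r : R, f r = g (φ r)) :
    AmalgamatedProduct φ →* G :=
  QuotientGroup.lift _ (Monoid.Coprod.lift f g) fun x hx =>
    (Subgroup.normalClosure_le_normal (N := (Monoid.Coprod.lift f g).ker) (by
      rintro _ ⟨r, rfl⟩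
      simp [MonoidHom.mem_ker, h r]) hx : x ∈ (Monoid.Coprod.lift f g).ker)

variable {G : Type*} [Group G] {f : P →* G} {g : Q →* G} (h : ∀ r : R, f r = g (φ r))

theorem lift_inl (p : P) : lift f g h (inl φ p) = f p := by
  simp [lift, inl]

theorem lift_inr (q : Q) : lift f g h (inr φ q) = g q := by
  simp [lift, inr]

theorem exists_list (x : AmalgamatedProduct φ) :
    ∃ L : List (P × Q), (L.map fun y => inl φ y.1 * inr φ y.2).prod = x := by
  obtain ⟨x, rfl⟩ := QuotientGroup.mk'_surjective _ x
  induction x using Monoid.Coprod.induction_on with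
  | inl p => exact ⟨[(p, 1)], by simp [inl]⟩
  | inr q => exact ⟨[(1, q)], by simp [inr]⟩
  | mul x y hx hy =>
    obtain ⟨L, hL⟩ := hx
    obtain ⟨L', hL'⟩ := hy
    exact ⟨L ++ L', by rw [List.map_append, List.prod_append, hL, hL', map_mul]⟩

end AmalgamatedProduct

end Amalgam

/-! ### Cyclic subgroups of the amalgamated product. -/

section Amalgam

variable {P Q : Type*} [Group P] [Group Q] {R : Subgroup P} {S : Subgroup Q} (φ : R ≃* S)

namespace AmalgamatedProduct

/-- The identity of `P` and the map `Q → S ≅ R` together retract `G` onto `P`. -/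
theorem isVirtualRetract_zpowers_inl (hS : S.IsRetract) (hP : PropertyVRC P) (p : P) :
    (Subgroup.zpowers (inl φ p)).IsVirtualRetract := by
  obtain ⟨ρ, hρ⟩ := hS
  exact isVirtualRetract_zpowers_of_section (inl φ)
    (lift (MonoidHom.id P) (R.subtype.comp (φ.symm.toMonoidHom.comp ρ)) fun r => by simp [hρ])
    (lift_inl φ _) (propertyVRC_iff.1 hP p)

theorem isVirtualRetract_zpowers_inr (hR : R.IsRetract) (hQ : PropertyVRC Q) (q : Q) :
    (Subgroup.zpowers (inr φ q)).IsVirtualRetract := by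
  obtain ⟨ρ, hρ⟩ := hR
  exact isVirtualRetract_zpowers_of_section (inr φ)
    (lift (S.subtype.comp (φ.toMonoidHom.comp ρ)) (MonoidHom.id Q) fun r => by simp [hρ])
    (lift_inr φ _) (propertyVRC_iff.1 hQ q)

theorem isVirtualRetract_zpowers_alternating (hR : R.IsRetract) (hS : S.IsRetract)
    (hP : PropertyVRC P) (hQ : PropertyVRC Q) {L : List (P × Q)} (hL : L ≠ [])
    (hLR : ∀ x ∈ L, x.1 ∉ R) (hLS : ∀ x ∈ L, x.2 ∉ S) :
    (Subgroup.zpowers (L.map fun x => inl φ x.1 * inr φ x.2).prod).IsVirtualRetract := by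
  obtain ⟨ρ, hρ⟩ := hR
  obtain ⟨τ, hτ⟩ := hS
  obtain ⟨M, hMn, hMf, hM⟩ := hP.exists_normal_finiteIndex_notMem
    (L.map fun x => (ρ x.1 : P)⁻¹ * x.1) <| by
      simp only [List.mem_map]
      rintro _ ⟨x, hx, rfl⟩ h
      exact hLR x hx (inv_mul_eq_one.1 h ▸ (ρ x.1).2)
  obtain ⟨N, hNn, hNf, hN⟩ := hQ.exists_normal_finiteIndex_notMem
    (L.map fun x => (τ x.2 : Q)⁻¹ * x.2) <| by
      simp only [List.mem_map]
      rintro _ ⟨x, hx, rfl⟩ h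
      exact hLS x hx (inv_mul_eq_one.1 h ▸ (τ x.2).2)
  -- Taking `T` below both `M` and the pullback of `N` gives one finite common retract `R ⧸ T ≃* S ⧸
  -- U`. The extra factor `R ⧸ T` in `reduction` is there because `ρ` need not descend to `P ⧸ M`.
  let T : Subgroup R := M.subgroupOf R ⊓ (N.subgroupOf S).comap φ.toMonoidHom
  have hTM : T ≤ M.subgroupOf R := inf_le_left
  let U : Subgroup S := T.comap φ.symm.toMonoidHom
  have hUN : U ≤ N.subgroupOf S := fun s hs => by
    have := hs.2
    simpa using this
  have : ((N.subgroupOf S).comap φ.toMonoidHom).FiniteIndex := finiteIndex_comap _ _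
  have hUf : U.FiniteIndex := finiteIndex_comap _ _
  let ψ : R ⧸ T ≃* S ⧸ U := QuotientGroup.congr T U φ <| by
    exact Subgroup.map_equiv_eq_comap_symm' φ T
  let A := L.map fun x => (reduction ρ M T x.1, reduction τ N U x.2)
  obtain ⟨Φ, Φ', hΦ, hc, hc', y, hy⟩ := exists_translation_action
    (reductionSection M T hTM) (MonoidHom.snd _ _) (fun _ => rfl)
    ((reductionSection N U hUN).comp ψ.toMonoidHom)
    (ψ.symm.toMonoidHom.comp (MonoidHom.snd _ _)) (fun c => by simp [reductionSection])
    A (by simpa [A] using hL)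
    (by
      simp only [A, List.mem_map]
      rintro _ ⟨x, hx, rfl⟩
      exact reduction_notMem M T hTM (hM _ (List.mem_map_of_mem hx)))
    (by
      simp only [A, List.mem_map]
      rintro _ ⟨x, hx, rfl⟩ h
      exact reduction_notMem N U hUN (hN _ (List.mem_map_of_mem hx)) <|
        let ⟨c, hc⟩ := h
        ⟨ψ c, hc⟩)
  let F := lift (φ := φ) (Φ.comp (reduction ρ M T)) (Φ'.comp (reduction τ N U)) fun r => by
    simp only [MonoidHom.comp_apply]
    rw [reduction_coe hρ M T hTM, reduction_coe hτ N U hUN, hΦ]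
    rfl
  have hF : ∀ x z, Commute (F x) (translation _ _ z) := fun x z => by
    obtain ⟨l, rfl⟩ := exists_list φ x
    induction l with
    | nil =>
      rw [List.map_nil, List.prod_nil, map_one]
      exact Commute.one_left _
    | cons a l ih =>
      rw [List.map_cons, List.prod_cons, map_mul, map_mul]
      refine (Commute.mul_left ?_ ?_).mul_left ih
      · rw [lift_inl]
        exact hc _ z
      · rw [lift_inr]
        exact hc' _ z
  refine isVirtualRetract_zpowers_of_translation F hF (y := y) ?_
  rw [← hy, map_list_prod, List.map_map, List.map_map]
  congr 3

theorem isVirtualRetract_zpowers_list (hR : R.IsRetract) (hS : S.IsRetract)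
    (hP : PropertyVRC P) (hQ : PropertyVRC Q) (L : List (P × Q)) :
    (Subgroup.zpowers (L.map fun x => inl φ x.1 * inr φ x.2).prod).IsVirtualRetract := by
  induction hn : L.length generalizing L with
  | zero =>
    obtain rfl := List.length_eq_zero_iff.1 hn
    simpa using isVirtualRetract_zpowers_inl φ hS hP 1
  | succ n ih =>
    by_cases hL : ∀ x ∈ L, x.1 ∉ R ∧ x.2 ∉ S
    · exact isVirtualRetract_zpowers_alternating φ hR hS hP hQ (by rintro rfl; simp at hn)
        (fun x hx => (hL x hx).1) fun x hx => (hL x hx).2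
    push Not at hL
    obtain ⟨⟨p, q⟩, hx, hpq⟩ := hL
    obtain ⟨L₁, L₂, rfl⟩ := List.append_of_mem hx
    rw [List.map_append, List.prod_append]
    -- Rotating the word is a conjugation; it puts the offending pair first.
    refine isVirtualRetract_zpowers_mul_comm ?_
    rw [← List.prod_append, ← List.map_append, List.cons_append]
    have hlen : (L₂ ++ L₁).length = n := by
      simp only [List.length_append, List.length_cons] at hn ⊢
      omega
    generalize L₂ ++ L₁ = M at hlen
    -- If `p ∈ R`, the pair is one element of `Q`, absorbed by the cyclically preceding letter; if
    -- `q ∈ S`, it is one element of `P`, absorbed by the next letter.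
    by_cases hp : p ∈ R
    · have hp' : inl φ p = inr φ (φ ⟨p, hp⟩) := inl_eq_inr φ ⟨p, hp⟩
      rcases M.eq_nil_or_concat with rfl | ⟨M, ⟨p', q'⟩, rfl⟩
      · simpa [hp'] using isVirtualRetract_zpowers_inr φ hR hQ (φ ⟨p, hp⟩ * q)
      · have := ih (M ++ [(p', q' * (φ ⟨p, hp⟩ * q))]) (by simpa using hlen)
        rw [List.map_cons, List.prod_cons]
        refine isVirtualRetract_zpowers_mul_comm ?_
        simpa [hp', mul_assoc] using this
    · have hq := hpq hp
      have hq' : inr φ q = inl φ (φ.symm ⟨q, hq⟩) := by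
        rw [inl_eq_inr]
        simp
      cases M with
      | nil => simpa [hq'] using isVirtualRetract_zpowers_inl φ hS hP (p * φ.symm ⟨q, hq⟩)
      | cons y M =>
        have := ih ((p * φ.symm ⟨q, hq⟩ * y.1, y.2) :: M) (by simpa using hlen)
        simpa [hq', mul_assoc] using this

end AmalgamatedProduct

end Amalgam

theorem mainTheorem5 {P : Type u} {Q : Type v} [Group P] [Group Q]
    (R : Subgroup P) (S : Subgroup Q) (hR : R.IsRetract) (hS : S.IsRetract) (φ : R ≃* S)
    (hP : PropertyVRC P) (hQ : PropertyVRC Q) :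
    PropertyVRC (AmalgamatedProduct φ) := by
  refine propertyVRC_iff.2 fun g => ?_
  obtain ⟨L, rfl⟩ := AmalgamatedProduct.exists_list φ g
  exact AmalgamatedProduct.isVirtualRetract_zpowers_list φ hR hS hP hQ L
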